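/- Consider a restricted Boltzmann machine with $n_V$ visible and $n_H$ hidden binary units and real parameters $\mathbf W=(\mathbf W',\mathbf b,\mathbf a)$. Its states are $\mathbf x=(\mathbf v,\mathbf h)\in\Omega=\{0,1\}^{n_V}\times\{0,1\}^{n_H}$, its energy is $E(\mathbf x;\mathbf W)=-\mathbf v^{\mathsf T}\mathbf W'\mathbf h-\mathbf b^{\mathsf T}\mathbf v-\mathbf a^{\mathsf T}\mathbf h$, and $p(\mathbf x;\mathbf W)=e^{-E(\mathbf x;\mathbf W)}/Z(\mathbf W)$ with $Z(\mathbf W)=\sum_{\mathbf x\in\Omega}e^{-E(\mathbf x;\mathbf W)}$. Let $\mathbf v_1,\dots,\mathbf v_N\in\{0,1\}^{n_V}$, $N\ge1$, be training data, and let $$\mathcal L(\mathbf W)=-\frac1N\sum_{n=1}^N\log\sum_{\mathbf h}p((\mathbf v_n,\mathbf h);\mathbf W)$$ be the average negative log-likelihood. The function $\mathcal L$ is differentiable, and the part of its gradient that belongs to $\mathbf W'$ is $-\big(\frac1N\sum_n\mathbf v_n\,\mathbb E_{\mathbf W}[\mathbf h\mid\mathbf v_n]^{\mathsf T}-\mathbb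 E_{\mathbf W}[\mathbf v\mathbf h^{\mathsf T}]\big)$. Let $\Phi$ be an irreducible Markov chain on $\Omega$ with stationary distribution $p(\cdot\,;\mathbf W)$ (for instance a time-reversible one). Let $\mathcal S\subseteq\Omega$ be a fixed nonempty stopping set, $Z_{\mathcal S}(\mathbf W)=\sum_{\mathbf y\in\mathcal S}e^{-E(\mathbf y;\mathbf W)}$, $R\ge1$ and $\eta>0$. Run $R$ independent copies $\mathbf X^{(r)}(1),\mathbf X^{(r)}(2),\dots$ of $\Phi$, each with $\mathbf X^{(r)}(1)=\mathbf y\in\mathcal S$ with probability $e^{-E(\mathbf y;\mathbf W)}/Z_{\mathcal S}(\mathbf W)$. Let $\xi^{(r)}=\min\{k\ge1:\mathbf X^{(r)}(k+1)\in\mathcal S\}$ be the length of the $r$-th tour, and let $\mathcal C_k$ be the family of the tours $(\mathbf X^{(r)}(1),\dots,\mathbf X^{(r)}(k))$ with $\xi^{(r)}=k$. For completed training points $\mathbf x_n$ the LVS-$K$ estimator is $$\widehat{\nabla_{\mathbf W}\mathcal L_{\mathrm{LVS}}}(K,R)=\eta\left(\frac{\widehat{\mathbb E}[\xi]}{N}\sum_{n=1}^N\frac{\partial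 E(\mathbf x_n;\mathbf W)}{\partial\mathbf W}-\frac{\sum_{k=1}^K\sum_{(\mathbf X(1),\dots,\mathbf X(k))\in\mathcal C_k}\sum_{i=1}^k\frac{\partial E(\mathbf X(i);\mathbf W)}{\partial\mathbf W}}{\sum_{k=1}^K|\mathcal C_k|}\right),\qquad \widehat{\mathbb E}[\xi]=\frac{\sum_{k=1}^Kk\,|\mathcal C_k|}{\sum_{k=1}^K|\mathcal C_k|}.$$ Let $K_{\mathrm{dyn}}$ be the least $K$ such that all $R$ tours have reached $\mathcal S$ within $K$ steps, i.e. $K_{\mathrm{dyn}}=\max_r\xi^{(r)}$. The training points are completed either (i) by the conditional means, $\mathbf x_n=(\mathbf v_n,\mathbb E_{\mathbf W}[\mathbf h\mid\mathbf v_n])$, with $E$ extended to real vectors by the same formula, or (ii) by sampling, $\mathbf x_n=(\mathbf v_n,\mathbf h_n)$ with $\mathbf h_n\sim p(\mathbf h\mid\mathbf v_n;\mathbf W)$ and $(\mathbf h_1,\dots,\mathbf h_N)$ independent of the tours. Then $K_{\mathrm{dyn}}$ is finite almost surely, and in both cases the estimator $\widehat{\nabla_{\mathbf W}\mathcal L_{\mathrm{LVS}}}(K_{\mathrm{dyn}},R)$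 is integrable with $$\mathbb E\left[\widehat{\nabla_{\mathbf W}\mathcal L_{\mathrm{LVS}}}(K_{\mathrm{dyn}},R)\right]=\eta\,\frac{Z(\mathbf W)}{Z_{\mathcal S}(\mathbf W)}\,\nabla_{\mathbf W}\mathcal L(\mathbf W),\qquad \eta\,\frac{Z(\mathbf W)}{Z_{\mathcal S}(\mathbf W)}>0,$$ so that it is an unbiased estimate of the direction of the RBM gradient. -/

import Mathlib

open MeasureTheory ProbabilityTheory

namespace RBM

/-- The parameters `W = (W', b, a)` of an RBM with `nV` visible and `nH` hidden units, as a
Euclidean vector with coordinates `W' i j`, `b i`, `a j`. -/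
abbrev Params (nV nH : ℕ) : Type :=
  EuclideanSpace ℝ ((Fin nV × Fin nH) ⊕ (Fin nV ⊕ Fin nH))

/-- States `x = (v, h)`: a visible and a hidden binary vector. -/
abbrev State (nV nH : ℕ) : Type := (Fin nV → Bool) × (Fin nH → Bool)

/-- A binary vector regarded as a real `0/1` vector. -/
def bits {n : ℕ} (v : Fin n → Bool) : Fin n → ℝ := fun i => if v i then 1 else 0

variable {nV nH : ℕ}

/-- Real coordinates of a state. -/
def State.real (x : State nV nH) : (Fin nV → ℝ) × (Fin nH → ℝ) := (bits x.1, bits x.2)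

/-- The energy `E((v, h); W) = - vᵀ W' h - bᵀ v - aᵀ h`, on real vectors `v`, `h`. -/
noncomputable def energy (x : (Fin nV → ℝ) × (Fin nH → ℝ)) (W : Params nV nH) : ℝ :=
  - (∑ i, ∑ j, x.1 i * W (Sum.inl (i, j)) * x.2 j)
    - (∑ i, W (Sum.inr (Sum.inl i)) * x.1 i)
    - ∑ j, W (Sum.inr (Sum.inr j)) * x.2 j

/-- The gradient `∂E(x; W)/∂W` of the energy in all the parameters. -/
noncomputable def energyGrad (x : (Fin nV → ℝ) × (Fin nH → ℝ)) (W : Params nV nH) :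
    Params nV nH :=
  gradient (fun W' => energy x W') W

/-- The unnormalized weight `exp (-E(x; W))` of a state. -/
noncomputable def weight (W : Params nV nH) (x : State nV nH) : ℝ :=
  Real.exp (- energy x.real W)

/-- `Z_S(W)`, the total weight of a set of states. -/
noncomputable def setWeight (W : Params nV nH) (S : Finset (State nV nH)) : ℝ :=
  ∑ x ∈ S, weight W x

/-- The partition function `Z(W)`. -/
noncomputable def partitionFn (W : Params nV nH) : ℝ := ∑ x, weight W x

/-- The model distribution `p(x; W)`. -/
noncomputable def prob (W : Params nV nH) (x : State nV nH) : ℝ := weight W x / partitionFn W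

/-- The conditional probability `p(h | v; W)`. -/
noncomputable def condProb (W : Params nV nH) (v : Fin nV → Bool) (h : Fin nH → Bool) : ℝ :=
  prob W (v, h) / ∑ h', prob W (v, h')

/-- The conditional mean `𝔼_W[h | v]`, a real vector. -/
noncomputable def condMean (W : Params nV nH) (v : Fin nV → Bool) : Fin nH → ℝ :=
  fun j => ∑ h, condProb W v h * bits h j

/-- The average negative log-likelihood `- (1/N) ∑ₙ log (∑ₕ p((vₙ, h); W))` of the training
data, as a function of the parameters. -/
noncomputable def negLogLik {N : ℕ} (v : Fin N → Fin nV → Bool) (W : Params nV nH) : ℝ :=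
  - ((1 / (N : ℝ)) * ∑ n, Real.log (∑ h, prob W (v n, h)))

/-- The starting distribution of a tour: `x ∈ S` has probability `exp (-E(x; W)) / Z_S(W)`. -/
noncomputable def startProb (W : Params nV nH) (S : Finset (State nV nH)) (x : State nV nH) : ℝ :=
  if x ∈ S then weight W x / setWeight W S else 0

/-- `X 0, X 1, …` is a time-homogeneous Markov chain under `μ` with the initial distribution `p₀`
and the transition matrix `Φ`. -/
structure IsMarkovChain {Ω α : Type*} [MeasurableSpace Ω] [MeasurableSpace α] (μ : Measure Ω)
    (p₀ : α → ℝ) (Φ : Matrix α α ℝ) (X : ℕ → Ω → α) : Prop where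
  measurable : ∀ t, Measurable (X t)
  law : ∀ (t : ℕ) (x : ℕ → α),
    μ.real {ω | ∀ i ≤ t, X i ω = x i} = p₀ (x 0) * ∏ i ∈ Finset.range t, Φ (x i) (x (i + 1))

/-- The length `ξ` of the tour of the path `x 0, x 1, …` : the first time `k ≥ 1` at which
`x k ∈ S`; the states of the tour are `x 0, …, x (ξ - 1)`. The value is `0`, which is never the
length of a finished tour, if the path does not return to `S`. -/
noncomputable def tourLength {α : Type*} (S : Finset α) (x : ℕ → α) : ℕ :=
  sInf {k | 1 ≤ k ∧ x k ∈ S}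

/-- `𝒞ₖ`: (the indices of) the tours that are finished in exactly `k` steps, for `k ≥ 1`. -/
noncomputable def finishedTours {α : Type*} {R : ℕ} (S : Finset α) (x : Fin R → ℕ → α) (k : ℕ) :
    Finset (Fin R) :=
  Finset.univ.filter fun r => tourLength S (x r) = k

/-- The number `∑_{k=1}^K |𝒞ₖ|` of tours that are finished within `K` steps. -/
noncomputable def numFinished {α : Type*} {R : ℕ} (S : Finset α) (K : ℕ) (x : Fin R → ℕ → α) :
    ℝ :=
  ∑ k ∈ Finset.Icc 1 K, ((finishedTours S x k).card : ℝ)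

/-- The empirical mean length of the tours that are finished within `K` steps. -/
noncomputable def meanTourLength {α : Type*} {R : ℕ} (S : Finset α) (K : ℕ)
    (x : Fin R → ℕ → α) : ℝ :=
  (∑ k ∈ Finset.Icc 1 K, ((finishedTours S x k).card : ℝ) * k) / numFinished S K x

/-- The LVS-`K` estimator with learning rate `η`, from the training points `y 1, …, y N`
and the `R` tours of the paths `x 1, …, x R`, truncated at `K` steps. -/
noncomputable def lvs {N R : ℕ} (W : Params nV nH) (S : Finset (State nV nH)) (η : ℝ)
    (y : Fin N → (Fin nV → ℝ) × (Fin nH → ℝ)) (K : ℕ) (x : Fin R → ℕ → State nV nH) :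
    Params nV nH :=
  η • ((meanTourLength S K x / (N : ℝ)) • (∑ n, energyGrad (y n) W)
    - (numFinished S K x)⁻¹ •
        ∑ k ∈ Finset.Icc 1 K, ∑ r ∈ finishedTours S x k, ∑ i ∈ Finset.range k,
          energyGrad (x r i).real W)

/-- `K` steps are enough for all the tours to reach `S`. -/
def AllStopped {α : Type*} {R : ℕ} (S : Finset α) (x : Fin R → ℕ → α) (K : ℕ) : Prop :=
  ∀ r, ∃ k, 1 ≤ k ∧ k ≤ K ∧ x r k ∈ S

/-- `K_dyn`: the bound `K` is grown until all the tours have reached `S`. -/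
noncomputable def kDyn {α : Type*} {R : ℕ} (S : Finset α) (x : Fin R → ℕ → α) : ℕ :=
  sInf {K | AllStopped S x K}

end RBM

/-!
The estimator, stopped at `K_dyn`, is unbiased up to the factor `Z / Z_S` by the cycle formula for
Markov chains (Kac's formula for a set).

Let `π = (Z / Z_S) • p`, a stationary measure of mass one on the stopping set `S`; a tour starts in
the restriction of `π` to `S`. Let `ν n` be the law of the chain at time `n`, restricted to the
event that the chain has not returned to `S` at the times `1, …, n`. By the Markov property
(`IsMarkovChain.measureReal_alive_succ`), `ν (n + 1)` is `ν n` moved by `Φ` and then restricted to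
the complement of `S`. Stationarity gives `∑ ν ≤ π`, and the difference is a nonnegative measure
that vanishes on `S` and is, by conservation of mass, again stationary; irreducibility makes it zero
(`hasSum_killed`). Thus a tour visits the state `x` on average `π x` times
(`IsMarkovChain.integral_visits`). In particular its expected length `∑ x, π x` is `Z / Z_S`, and
it returns to `S` almost surely.

At `K_dyn` all tours count, so the estimator is linear in the numbers of visits (`lvs_kDyn_eq`), and
its expectation is
`η (Z / Z_S) ((1/N) ∑ₙ 𝔼[∂E(xₙ)] - ∑ₓ p(x) ∂E(x))`, where the independence of the completed data
from the tours is used for the first term (`integrable_and_integral_lvs_kDyn`). The energy is linear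
in the parameters, with the gradient `-(v hᵀ, v, h)`, and this is affine in `h`; hence conditional
means and samples from the conditional law give the same `𝔼[∂E(xₙ)]`, and the bracket is the
gradient of `ℒ` (`hasGradientAt_negLogLik`).
-/

namespace RBM

/-! ### Stationary measures and the chain killed on a set -/

section Killed

variable {α : Type*} [Fintype α] [DecidableEq α] {Φ : Matrix α α ℝ}

/-- A nonnegative stationary measure of an irreducible matrix is zero if one of its values is: any
mass at `x` would be carried to `s` by a power of `Φ`. -/
theorem eq_zero_of_stationary_of_apply_eq_zero (hirr : Φ.IsIrreducible) {ρ : α → ℝ}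
    (hρ : ∀ x, 0 ≤ ρ x) (hst : Matrix.vecMul ρ Φ = ρ) {s : α} (hs : ρ s = 0) : ρ = 0 := by
  have hpow : ∀ k : ℕ, Matrix.vecMul ρ (Φ ^ k) = ρ := by
    intro k
    induction k with
    | zero => simp
    | succ k ih => rw [pow_succ, ← Matrix.vecMul_vecMul, ih, hst]
  funext x
  obtain ⟨k, -, hk⟩ := (Matrix.isIrreducible_iff_exists_pow_pos hirr.nonneg).1 hirr x s
  have h0 : ∑ y, ρ y * (Φ ^ k) y s = 0 := by
    have := congrFun (hpow k) s
    rwa [hs] at this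
  have h1 := (Finset.sum_eq_zero_iff_of_nonneg fun y _ =>
    mul_nonneg (hρ y) (Matrix.pow_apply_nonneg hirr.nonneg k y s)).1 h0 x (Finset.mem_univ x)
  exact (mul_eq_zero.1 h1).resolve_right hk.ne'

/-- The cycle formula in matrix form: if the part of a stationary measure `π` on `S` is evolved
by `Φ` and killed on `S`, then its total occupation is `π`. The defect `π - ∑ ν` is again
nonnegative and stationary, and it vanishes on `S`. -/
theorem hasSum_killed (hΦ : Φ ∈ Matrix.rowStochastic ℝ α) (hirr : Φ.IsIrreducible)
    {S : Finset α} (hS : S.Nonempty) {π : α → ℝ} (hπ : ∀ x, 0 ≤ π x)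
    (hst : Matrix.vecMul π Φ = π) {ν : ℕ → α → ℝ} (hν0 : ∀ x, ν 0 x = if x ∈ S then π x else 0)
    (hν : ∀ n y, ν (n + 1) y = if y ∈ S then 0 else ∑ x, ν n x * Φ x y) (x : α) :
    HasSum (fun n => ν n x) (π x) := by
  have hst' : ∀ y, ∑ x, π x * Φ x y = π y := fun y => congrFun hst y
  have hνnn : ∀ n x, 0 ≤ ν n x := by
    intro n
    induction n with
    | zero => intro x; rw [hν0]; split_ifs <;> simp [hπ]
    | succ n ih =>
      intro x
      rw [hν]
      split_ifs
      · exact le_rfl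
      · exact Finset.sum_nonneg fun y _ => mul_nonneg (ih y) (hirr.nonneg y x)
  -- the defect evolves like `ν` itself, which propagates its nonnegativity
  have hrec : ∀ n y, π y - ∑ k ∈ Finset.range (n + 2), ν k y
      = if y ∈ S then 0 else ∑ x, (π x - ∑ k ∈ Finset.range (n + 1), ν k x) * Φ x y := by
    intro n y
    rw [Finset.sum_range_succ']
    simp only [hν, hν0]
    split_ifs with hy
    · simp
    · simp only [sub_mul, Finset.sum_sub_distrib, hst', Finset.sum_mul, add_zero]
      rw [Finset.sum_comm]
  have hnn : ∀ n y, 0 ≤ π y - ∑ k ∈ Finset.range (n + 1), ν k y := by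
    intro n
    induction n with
    | zero => intro y; simp only [zero_add, Finset.sum_range_one, hν0]; split_ifs <;> simp [hπ]
    | succ n ih =>
      intro y
      rw [hrec]
      split_ifs
      · exact le_rfl
      · exact Finset.sum_nonneg fun x _ => mul_nonneg (ih x) (hirr.nonneg x y)
  have hsum : ∀ x, Summable fun n => ν n x := fun x =>
    summable_of_sum_range_le (c := π x) (fun n => hνnn n x) fun n => by
      have h1 := hnn n x
      rw [Finset.sum_range_succ] at h1
      linarith [hνnn n x]
  have htend : ∀ y, Filter.Tendsto (fun n => π y - ∑ k ∈ Finset.range n, ν k y) Filter.atTop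
      (nhds (π y - ∑' k, ν k y)) := fun y =>
    tendsto_const_nhds.sub (hsum y).hasSum.tendsto_sum_nat
  set ρ : α → ℝ := fun y => π y - ∑' k, ν k y with hρdef
  have hρnn : ∀ y, 0 ≤ ρ y := fun y =>
    ge_of_tendsto' ((Filter.tendsto_add_atTop_iff_nat 1).2 (htend y)) fun n => hnn n y
  have hρrec : ∀ y, ρ y = if y ∈ S then 0 else ∑ x, ρ x * Φ x y := by
    intro y
    refine tendsto_nhds_unique ((Filter.tendsto_add_atTop_iff_nat 2).2 (htend y)) ?_
    simp only [hrec]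
    split_ifs
    · exact tendsto_const_nhds
    · exact tendsto_finsetSum _ fun x _ =>
        ((Filter.tendsto_add_atTop_iff_nat 1).2 (htend x)).mul_const _
  -- `ρ ≤ ρ Φ` pointwise and both sides have the same total mass
  have hle : ∀ y, ρ y ≤ ∑ x, ρ x * Φ x y := by
    intro y
    conv_lhs => rw [hρrec y]
    split_ifs
    · exact Finset.sum_nonneg fun x _ => mul_nonneg (hρnn x) (hirr.nonneg x y)
    · exact le_rfl
  have hmass : ∑ y, ρ y = ∑ y, ∑ x, ρ x * Φ x y := by
    rw [Finset.sum_comm]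
    simp [← Finset.mul_sum, Matrix.sum_row_of_mem_rowStochastic hΦ]
  have hρst : Matrix.vecMul ρ Φ = ρ := by
    funext y
    exact ((Finset.sum_eq_sum_iff_of_le fun y _ => hle y).1 hmass y (Finset.mem_univ y)).symm
  obtain ⟨s, hs⟩ := hS
  have hρ0 := eq_zero_of_stationary_of_apply_eq_zero hirr hρnn hρst (s := s) (by
    rw [hρrec, if_pos hs])
  have hx : π x - ∑' k, ν k x = 0 := congrFun hρ0 x
  rw [sub_eq_zero.1 hx]
  exact (hsum x).hasSum

end Killed

/-! ### Gradients of the energy and of the log-likelihood -/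

section Gradient

variable {nV nH N : ℕ}

/-- The sufficient statistics `(v hᵀ, v, h)` of a point, so that `E(x; W) = -⟪feature x, W⟫`. -/
noncomputable def feature (x : (Fin nV → ℝ) × (Fin nH → ℝ)) : Params nV nH :=
  WithLp.toLp 2 (Sum.elim (fun p => x.1 p.1 * x.2 p.2) (Sum.elim x.1 x.2))

theorem energy_eq_neg_inner (x : (Fin nV → ℝ) × (Fin nH → ℝ)) (W : Params nV nH) :
    energy x W = -inner ℝ (feature x) W := by
  simp only [energy, feature, PiLp.inner_apply, Fintype.sum_sum_type, Fintype.sum_prod_type,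
    Sum.elim_inl, Sum.elim_inr, RCLike.inner_apply, conj_trivial, neg_add]
  have : ∀ i j, x.1 i * W (Sum.inl (i, j)) * x.2 j = W (Sum.inl (i, j)) * (x.1 i * x.2 j) :=
    fun i j => by ring
  simp only [this]
  ring

theorem hasGradientAt_energy (x : (Fin nV → ℝ) × (Fin nH → ℝ)) (W : Params nV nH) :
    HasGradientAt (fun W' => energy x W') (-feature x) W := by
  simp only [energy_eq_neg_inner, hasGradientAt_iff_hasFDerivAt, map_neg]
  exact ((InnerProductSpace.toDual ℝ (Params nV nH) (feature x)).hasFDerivAt).neg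

theorem energyGrad_eq (x : (Fin nV → ℝ) × (Fin nH → ℝ)) (W : Params nV nH) :
    energyGrad x W = -feature x :=
  (hasGradientAt_energy x W).gradient

theorem weight_pos (W : Params nV nH) (x : State nV nH) : 0 < weight W x := Real.exp_pos _

theorem setWeight_pos (W : Params nV nH) {S : Finset (State nV nH)} (hS : S.Nonempty) :
    0 < setWeight W S :=
  Finset.sum_pos (fun x _ => weight_pos W x) hS

theorem partitionFn_pos (W : Params nV nH) : 0 < partitionFn W :=
  Finset.sum_pos (fun x _ => weight_pos W x) Finset.univ_nonempty

theorem prob_nonneg (W : Params nV nH) (x : State nV nH) : 0 ≤ prob W x :=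
  div_nonneg (weight_pos W x).le (partitionFn_pos W).le

theorem hasGradientAt_log_setWeight (W : Params nV nH) {S : Finset (State nV nH)}
    (hS : S.Nonempty) :
    HasGradientAt (fun W' => Real.log (setWeight W' S))
      (∑ x ∈ S, (weight W x / setWeight W S) • feature x.real) W := by
  have h1 : HasFDerivAt (fun W' => setWeight W' S)
      (∑ x ∈ S, weight W x • InnerProductSpace.toDual ℝ (Params nV nH) (feature x.real)) W := by
    refine HasFDerivAt.fun_sum fun x _ => ?_
    simp only [weight, energy_eq_neg_inner, neg_neg]
    exact ((InnerProductSpace.toDual ℝ (Params nV nH) (feature x.real)).hasFDerivAt).exp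
  rw [hasGradientAt_iff_hasFDerivAt]
  convert! h1.log (setWeight_pos W hS).ne' using 1
  simp only [map_sum, map_smul, Finset.smul_sum, smul_smul, div_eq_inv_mul]

theorem sum_prob_eq (W : Params nV nH) (v : Fin nV → Bool) :
    ∑ h, prob W (v, h) = setWeight W ({v} ×ˢ Finset.univ) / partitionFn W := by
  simp [prob, setWeight, Finset.sum_div]

theorem condProb_eq (W : Params nV nH) (v : Fin nV → Bool) (h : Fin nH → Bool) :
    condProb W v h = weight W (v, h) / setWeight W ({v} ×ˢ Finset.univ) := by
  rw [condProb, sum_prob_eq, prob, div_div_div_cancel_right₀ (partitionFn_pos W).ne']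

theorem sum_condProb (W : Params nV nH) (v : Fin nV → Bool) : ∑ h, condProb W v h = 1 := by
  have hne : (({v} : Finset (Fin nV → Bool)) ×ˢ
    (Finset.univ : Finset (Fin nH → Bool))).Nonempty := by simp
  simp only [condProb_eq, ← Finset.sum_div]
  rw [div_eq_one_iff_eq (setWeight_pos W hne).ne']
  simp [setWeight]

/-- For fixed `v` the feature vector is affine in `h`, so that its conditional mean is its value
at the conditional mean of `h`. -/
theorem sum_condProb_smul_feature (W : Params nV nH) (v : Fin nV → Bool) :
    ∑ h, condProb W v h • feature (State.real (v, h)) = feature (bits v, condMean W v) := by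
  ext i
  rw [WithLp.ofLp_sum, Finset.sum_apply]
  rcases i with ⟨i, j⟩ | i | j
  · simp only [feature, State.real, PiLp.smul_apply, Sum.elim_inl, smul_eq_mul, condMean,
      Finset.mul_sum]
    exact Finset.sum_congr rfl fun h _ => by ring
  · simp [feature, State.real, ← Finset.sum_mul, sum_condProb]
  · simp [feature, State.real, condMean]

theorem hasGradientAt_negLogLik (v : Fin N → Fin nV → Bool) (W : Params nV nH) (hN : 1 ≤ N) :
    HasGradientAt (negLogLik v)
      (∑ x, prob W x • feature x.real
        - (1 / (N : ℝ)) • ∑ n, feature (bits (v n), condMean W (v n))) W := by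
  have hne : ∀ v : Fin nV → Bool, (({v} : Finset (Fin nV → Bool)) ×ˢ
    (Finset.univ : Finset (Fin nH → Bool))).Nonempty := fun v => by simp
  have hN' : (N : ℝ) ≠ 0 := by exact_mod_cast (by omega : N ≠ 0)
  have heq : negLogLik v = fun W' : Params nV nH => Real.log (setWeight W' Finset.univ)
      - (1 / (N : ℝ)) * ∑ n, Real.log (setWeight W' ({v n} ×ˢ Finset.univ)) := by
    funext W'
    have : ∀ n, Real.log (∑ h, prob W' (v n, h)) =
        Real.log (setWeight W' ({v n} ×ˢ Finset.univ)) - Real.log (setWeight W' Finset.univ) := by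
      intro n
      rw [sum_prob_eq, Real.log_div (setWeight_pos W' (hne _)).ne' (partitionFn_pos W').ne']
      rfl
    simp only [negLogLik, this, Finset.sum_sub_distrib, Finset.sum_const, Finset.card_univ,
      Fintype.card_fin, nsmul_eq_mul]
    field_simp
    ring
  have hv : ∀ n, HasGradientAt
      (fun W' : Params nV nH => Real.log (setWeight W' ({v n} ×ˢ Finset.univ)))
      (feature (bits (v n), condMean W (v n))) W := by
    intro n
    convert hasGradientAt_log_setWeight W (hne (v n)) using 1
    rw [← sum_condProb_smul_feature]
    simp [condProb_eq]
  rw [heq, hasGradientAt_iff_hasFDerivAt, map_sub, map_smul,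
    map_sum _ _ (Finset.univ : Finset (Fin N))]
  exact (hasGradientAt_log_setWeight W Finset.univ_nonempty).hasFDerivAt.fun_sub
    ((HasFDerivAt.fun_sum fun n _ => (hv n).hasFDerivAt).const_mul _)

end Gradient

/-! ### Occupation of a state during a tour -/

section Tours

open scoped ENNReal

variable {α : Type*}

/-- The paths that are at `x` at time `n` and have not been in `S` at the times `1, …, n`. -/
def aliveAt (S : Finset α) (x : α) (n : ℕ) : Set (ℕ → α) :=
  {p | p n = x ∧ ∀ k, 1 ≤ k → k ≤ n → p k ∉ S}

/-- The number of visits of the path `p` to `x` during its first tour. If the path never returns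
to `S`, all its visits count, so that the value may be `∞`. -/
noncomputable def visits (S : Finset α) (x : α) (p : ℕ → α) : ℝ≥0∞ :=
  ∑' n, (aliveAt S x n).indicator 1 p

theorem measurableSet_aliveAt [MeasurableSpace α] [MeasurableSingletonClass α] (S : Finset α)
    (x : α) (n : ℕ) : MeasurableSet (aliveAt S x n) := by
  have h1 : MeasurableSet {p : ℕ → α | p n = x} :=
    (measurableSet_singleton x).preimage (measurable_pi_apply n)
  have h2 : ∀ k, MeasurableSet {p : ℕ → α | p k ∉ S} := fun k =>
    (S.measurableSet.preimage (measurable_pi_apply k)).compl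
  simp only [aliveAt, Set.ofPred_and, Set.ofPred_forall]
  exact h1.inter (.iInter fun k => .iInter fun _ => .iInter fun _ => h2 k)

theorem measurable_visits [MeasurableSpace α] [MeasurableSingletonClass α] (S : Finset α) (x : α) :
    Measurable (visits S x) :=
  Measurable.tsum fun n => measurable_one.indicator (measurableSet_aliveAt S x n)

theorem exists_mem_of_visits_ne_top [Fintype α] {S : Finset α} {p : ℕ → α}
    (h : ∀ x, visits S x p ≠ ∞) : ∃ k, 1 ≤ k ∧ p k ∈ S := by
  classical
  by_contra! hc
  have h1 : ∑ x, visits S x p = ∞ := by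
    have h2 : ∀ n x, (aliveAt S x n).indicator (1 : (ℕ → α) → ℝ≥0∞) p
        = if p n = x then 1 else 0 := by
      intro n x
      have : p ∈ aliveAt S x n ↔ p n = x := ⟨fun h => h.1, fun h => ⟨h, fun k hk _ => hc k hk⟩⟩
      simp [Set.indicator_apply, this]
    simp only [visits]
    rw [← Summable.tsum_finsetSum fun _ _ => ENNReal.summable]
    simp only [h2, Finset.sum_ite_eq, Finset.mem_univ, if_true]
    exact ENNReal.tsum_const_eq_top_of_ne_zero one_ne_zero
  exact ENNReal.sum_ne_top.2 (fun x _ => h x) h1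

theorem tourLength_spec {S : Finset α} {p : ℕ → α} (h : ∃ k, 1 ≤ k ∧ p k ∈ S) :
    1 ≤ tourLength S p ∧ p (tourLength S p) ∈ S :=
  Nat.sInf_mem (s := {k | 1 ≤ k ∧ p k ∈ S}) h

theorem tourLength_le {S : Finset α} {p : ℕ → α} {k : ℕ} (hk : 1 ≤ k) (hp : p k ∈ S) :
    tourLength S p ≤ k :=
  Nat.sInf_le (s := {k | 1 ≤ k ∧ p k ∈ S}) ⟨hk, hp⟩

theorem lt_tourLength_iff {S : Finset α} {p : ℕ → α} (h : ∃ k, 1 ≤ k ∧ p k ∈ S) (n : ℕ) :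
    n < tourLength S p ↔ ∀ k, 1 ≤ k → k ≤ n → p k ∉ S := by
  constructor
  · intro hn k hk hkn hp
    exact absurd (tourLength_le hk hp) (by omega)
  · intro hn
    by_contra! hc
    exact hn _ (tourLength_spec h).1 hc (tourLength_spec h).2

theorem toReal_visits [DecidableEq α] {S : Finset α} {p : ℕ → α} (h : ∃ k, 1 ≤ k ∧ p k ∈ S)
    (x : α) :
    (visits S x p).toReal = ∑ n ∈ Finset.range (tourLength S p), if p n = x then 1 else 0 := by
  have hmem : ∀ n, p ∈ aliveAt S x n ↔ p n = x ∧ n < tourLength S p := fun n => by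
    rw [lt_tourLength_iff h]
    rfl
  classical
  simp only [visits, Set.indicator_apply, hmem, Pi.one_apply]
  rw [tsum_eq_sum (s := Finset.range (tourLength S p)) (fun n hn => by
    rw [Finset.mem_range] at hn
    simp [hn]), ENNReal.toReal_sum (fun n _ => by split_ifs <;> simp)]
  refine Finset.sum_congr rfl fun n hn => ?_
  rw [Finset.mem_range] at hn
  simp only [hn, and_true]
  split_ifs <;> simp

theorem sum_toReal_visits_smul [Fintype α] {E : Type*} [AddCommGroup E] [Module ℝ E]
    {S : Finset α} {p : ℕ → α} (h : ∃ k, 1 ≤ k ∧ p k ∈ S) (g : α → E) :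
    ∑ x, (visits S x p).toReal • g x = ∑ n ∈ Finset.range (tourLength S p), g (p n) := by
  classical
  simp only [toReal_visits h, Finset.sum_smul]
  rw [Finset.sum_comm]
  simp [ite_smul]

theorem sum_toReal_visits [Fintype α] {S : Finset α} {p : ℕ → α} (h : ∃ k, 1 ≤ k ∧ p k ∈ S) :
    ∑ x, (visits S x p).toReal = tourLength S p := by
  simpa using sum_toReal_visits_smul h (fun _ => (1 : ℝ))

end Tours

/-! ### Expected occupation of a tour of a stationary Markov chain -/

section Markov

open scoped ENNReal

variable {Ω α : Type*} [MeasurableSpace Ω] [MeasurableSpace α] [MeasurableSingletonClass α]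
  [Fintype α] {μ : Measure Ω} [IsProbabilityMeasure μ] {p₀ : α → ℝ} {Φ : Matrix α α ℝ}
  {X : ℕ → Ω → α}

/-- The Markov property for events of the past. -/
theorem IsMarkovChain.measureReal_step (hX : IsMarkovChain μ p₀ Φ X) (n : ℕ)
    (Q : Set (Fin (n + 1) → α)) (x y : α) :
    μ.real {ω | ((fun i : Fin (n + 1) => X i ω) ∈ Q ∧ X n ω = x) ∧ X (n + 1) ω = y} =
      μ.real {ω | (fun i : Fin (n + 1) => X i ω) ∈ Q ∧ X n ω = x} * Φ x y := by
  classical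
  -- both events are finite disjoint unions over the values of the history `H` up to time `n`
  set H : Ω → Fin (n + 1) → α := fun ω i => X i ω with hH
  have hHm : Measurable H := measurable_pi_lambda _ fun i => hX.measurable i
  set T : Finset (Fin (n + 1) → α) := Finset.univ.filter fun p => p ∈ Q ∧ p (Fin.last n) = x
  have hset : {ω | H ω ∈ Q ∧ X n ω = x} = H ⁻¹' T := by
    ext ω
    simp [T, hH]
  have hset' : {ω | (H ω ∈ Q ∧ X n ω = x) ∧ X (n + 1) ω = y} =
      H ⁻¹' T ∩ {ω | X (n + 1) ω = y} := by
    rw [← hset]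
    rfl
  rw [hset', hset, ← measureReal_restrict_apply (hHm T.measurableSet),
    ← sum_measureReal_preimage_singleton T fun p _ => hHm (measurableSet_singleton p),
    ← sum_measureReal_preimage_singleton T fun p _ => hHm (measurableSet_singleton p),
    Finset.sum_mul]
  refine Finset.sum_congr rfl fun p hp => ?_
  rw [measureReal_restrict_apply (hHm (measurableSet_singleton p))]
  have hpx : p (Fin.last n) = x := (Finset.mem_filter.1 hp).2.2
  -- the path `p` followed by `y`, as a path defined at all times
  set z : ℕ → α := fun i => if h : i < n + 1 then p ⟨i, h⟩ else y with hz
  have hzn : z n = x := by simp [hz, ← hpx, Fin.last]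
  have hzy : z (n + 1) = y := by simp [hz]
  have e1 : H ⁻¹' {p} = {ω | ∀ i ≤ n, X i ω = z i} := by
    ext ω
    simp only [Set.mem_preimage, Set.mem_singleton_iff, Set.mem_ofPred_eq, hH, hz, funext_iff]
    constructor
    · intro h i hi
      rw [dif_pos (by omega)]
      exact h ⟨i, by omega⟩
    · intro h i
      have := h i (by omega)
      rwa [dif_pos i.2] at this
  have e2 : H ⁻¹' {p} ∩ {ω | X (n + 1) ω = y} = {ω | ∀ i ≤ n + 1, X i ω = z i} := by
    rw [e1]
    ext ω
    simp only [Set.mem_inter_iff, Set.mem_ofPred_eq]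
    constructor
    · rintro ⟨h, hy⟩ i hi
      rcases Nat.lt_or_ge n i with hni | hni
      · obtain rfl : i = n + 1 := by omega
        rw [hy, hzy]
      · exact h i hni
    · intro h
      exact ⟨fun i hi => h i (by omega), by rw [h (n + 1) le_rfl, hzy]⟩
  rw [e2, e1, hX.law, hX.law, Finset.prod_range_succ, hzn, hzy, mul_assoc]

/-- The chain killed at its first return to `S` evolves by the transition matrix with the columns
in `S` removed. -/
theorem IsMarkovChain.measureReal_alive_succ [DecidableEq α] (hX : IsMarkovChain μ p₀ Φ X)
    (S : Finset α) (n : ℕ) (y : α) :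
    μ.real {ω | X (n + 1) ω = y ∧ ∀ k, 1 ≤ k → k ≤ n + 1 → X k ω ∉ S} =
      if y ∈ S then 0 else
        ∑ x, μ.real {ω | X n ω = x ∧ ∀ k, 1 ≤ k → k ≤ n → X k ω ∉ S} * Φ x y := by
  split_ifs with hy
  · convert measureReal_empty (μ := μ)
    ext ω
    simp only [Set.mem_ofPred_eq, Set.mem_empty_iff_false, iff_false, not_and]
    intro h hk
    exact hk (n + 1) (by omega) le_rfl (h ▸ hy)
  · set Q : Set (Fin (n + 1) → α) := {p | ∀ k : Fin (n + 1), 1 ≤ (k : ℕ) → p k ∉ S}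
    have hQ : ∀ ω, (fun i : Fin (n + 1) => X i ω) ∈ Q ↔
        ∀ k, 1 ≤ k → k ≤ n → X k ω ∉ S := fun ω =>
      ⟨fun h k hk hkn => h ⟨k, by omega⟩ hk, fun h k hk => h k hk (by omega)⟩
    have hA : ∀ x, {ω | X n ω = x ∧ ∀ k, 1 ≤ k → k ≤ n → X k ω ∉ S} =
        {ω | (fun i : Fin (n + 1) => X i ω) ∈ Q ∧ X n ω = x} := by
      intro x
      ext ω
      simp only [Set.mem_ofPred_eq, hQ]
      exact and_comm
    simp only [hA, ← hX.measureReal_step]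
    -- the event is split according to the state at time `n`
    have hsplit := sum_measureReal_preimage_singleton
      (μ := μ.restrict {ω | X (n + 1) ω = y ∧ ∀ k, 1 ≤ k → k ≤ n + 1 → X k ω ∉ S})
      Finset.univ (f := X n) fun x _ => hX.measurable n (measurableSet_singleton x)
    rw [Finset.coe_univ, Set.preimage_univ, measureReal_restrict_apply .univ,
      Set.univ_inter] at hsplit
    rw [← hsplit]
    refine Finset.sum_congr rfl fun x _ => ?_
    rw [measureReal_restrict_apply (hX.measurable n (measurableSet_singleton x))]
    congr 1
    ext ω
    simp only [Set.mem_inter_iff, Set.mem_preimage, Set.mem_singleton_iff, Set.mem_ofPred_eq, hQ]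
    constructor
    · rintro ⟨h1, h2, h3⟩
      exact ⟨⟨fun k hk hkn => h3 k hk (by omega), h1⟩, h2⟩
    · rintro ⟨⟨h3, h1⟩, h2⟩
      refine ⟨h1, h2, fun k hk hkn => ?_⟩
      rcases Nat.lt_or_ge n k with hnk | hnk
      · obtain rfl : k = n + 1 := by omega
        rwa [h2]
      · exact h3 k hk hnk

variable [DecidableEq α] {S : Finset α} {π : α → ℝ}

/-- The cycle formula: for the start in the part of a stationary measure `π` on `S`, the expected
number of visits to `x` before the return to `S` is `π x`. -/
theorem IsMarkovChain.lintegral_visits (hΦ : Φ ∈ Matrix.rowStochastic ℝ α)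
    (hirr : Φ.IsIrreducible) (hS : S.Nonempty) (hπ : ∀ x, 0 ≤ π x)
    (hst : Matrix.vecMul π Φ = π)
    (hX : IsMarkovChain μ (fun x => if x ∈ S then π x else 0) Φ X) (x : α) :
    ∫⁻ ω, visits S x (fun t => X t ω) ∂μ = ENNReal.ofReal (π x) := by
  classical
  have hpm : Measurable fun ω t => X t ω := measurable_pi_lambda _ fun t => hX.measurable t
  have hsum := hasSum_killed hΦ hirr hS hπ hst
    (ν := fun n x => μ.real {ω | X n ω = x ∧ ∀ k, 1 ≤ k → k ≤ n → X k ω ∉ S})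
    (fun x => by
      have h := hX.law 0 fun _ => x
      simp only [Finset.range_zero, Finset.prod_empty, mul_one] at h
      rw [← h]
      congr 1
      ext ω
      simp only [Set.mem_ofPred_eq, Nat.le_zero, forall_eq]
      exact ⟨fun h => h.1, fun h => ⟨h, fun k hk hk0 => by omega⟩⟩)
    (fun n y => hX.measureReal_alive_succ S n y) x
  rw [← hsum.tsum_eq, ENNReal.ofReal_tsum_of_nonneg (fun n => measureReal_nonneg) hsum.summable]
  simp only [visits]
  have hm : ∀ n, Measurable fun ω =>
      (aliveAt S x n).indicator (1 : (ℕ → α) → ℝ≥0∞) fun t => X t ω := fun n =>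
    (measurable_one.indicator (measurableSet_aliveAt S x n)).comp hpm
  rw [lintegral_tsum fun n => (hm n).aemeasurable]
  refine tsum_congr fun n => ?_
  rw [ofReal_measureReal]
  exact lintegral_indicator_one (hpm (measurableSet_aliveAt S x n))

theorem IsMarkovChain.integrable_visits (hΦ : Φ ∈ Matrix.rowStochastic ℝ α)
    (hirr : Φ.IsIrreducible) (hS : S.Nonempty) (hπ : ∀ x, 0 ≤ π x)
    (hst : Matrix.vecMul π Φ = π)
    (hX : IsMarkovChain μ (fun x => if x ∈ S then π x else 0) Φ X) (x : α) :
    Integrable (fun ω => (visits S x fun t => X t ω).toReal) μ :=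
  integrable_toReal_of_lintegral_ne_top
    ((measurable_visits S x).comp
      (measurable_pi_lambda _ fun t => hX.measurable t)).aemeasurable
    (by rw [hX.lintegral_visits hΦ hirr hS hπ hst]; exact ENNReal.ofReal_ne_top)

theorem IsMarkovChain.ae_visits_lt_top (hΦ : Φ ∈ Matrix.rowStochastic ℝ α)
    (hirr : Φ.IsIrreducible) (hS : S.Nonempty) (hπ : ∀ x, 0 ≤ π x)
    (hst : Matrix.vecMul π Φ = π)
    (hX : IsMarkovChain μ (fun x => if x ∈ S then π x else 0) Φ X) (x : α) :
    ∀ᵐ ω ∂μ, visits S x (fun t => X t ω) < ∞ :=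
  ae_lt_top ((measurable_visits S x).comp
      (measurable_pi_lambda _ fun t => hX.measurable t))
    (by rw [hX.lintegral_visits hΦ hirr hS hπ hst]; exact ENNReal.ofReal_ne_top)

theorem IsMarkovChain.integral_visits (hΦ : Φ ∈ Matrix.rowStochastic ℝ α)
    (hirr : Φ.IsIrreducible) (hS : S.Nonempty) (hπ : ∀ x, 0 ≤ π x)
    (hst : Matrix.vecMul π Φ = π)
    (hX : IsMarkovChain μ (fun x => if x ∈ S then π x else 0) Φ X) (x : α) :
    ∫ ω, (visits S x fun t => X t ω).toReal ∂μ = π x := by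
  have hm : Measurable fun ω => visits S x fun t => X t ω :=
    (measurable_visits S x).comp (measurable_pi_lambda _ fun t => hX.measurable t)
  rw [integral_toReal hm.aemeasurable
      (hX.ae_visits_lt_top hΦ hirr hS hπ hst x),
    hX.lintegral_visits hΦ hirr hS hπ hst, ENNReal.toReal_ofReal (hπ x)]

theorem IsMarkovChain.ae_exists_return (hΦ : Φ ∈ Matrix.rowStochastic ℝ α)
    (hirr : Φ.IsIrreducible) (hS : S.Nonempty) (hπ : ∀ x, 0 ≤ π x)
    (hst : Matrix.vecMul π Φ = π)
    (hX : IsMarkovChain μ (fun x => if x ∈ S then π x else 0) Φ X) :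
    ∀ᵐ ω ∂μ, ∃ k, 1 ≤ k ∧ X k ω ∈ S := by
  filter_upwards [ae_all_iff.2 fun x => hX.ae_visits_lt_top hΦ hirr hS hπ hst x] with ω hω
  exact exists_mem_of_visits_ne_top (p := fun t => X t ω) fun x => (hω x).ne

end Markov

/-! ### The estimator stopped at `K_dyn` -/

section Estimator

variable {nV nH N R : ℕ}

theorem sum_finishedTours {α E : Type*} [AddCommMonoid E] {S : Finset α} {x : Fin R → ℕ → α}
    {K : ℕ} (hK : ∀ r, 1 ≤ tourLength S (x r) ∧ tourLength S (x r) ≤ K) (F : ℕ → Fin R → E) :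
    ∑ k ∈ Finset.Icc 1 K, ∑ r ∈ finishedTours S x k, F k r = ∑ r, F (tourLength S (x r)) r := by
  rw [← Finset.sum_fiberwise_of_maps_to (s := Finset.univ) (t := Finset.Icc 1 K)
    (g := fun r => tourLength S (x r)) fun r _ => Finset.mem_Icc.2 (hK r)]
  refine Finset.sum_congr rfl fun k _ => Finset.sum_congr rfl fun r hr => ?_
  rw [(Finset.mem_filter.1 hr).2]

theorem tourLength_le_kDyn {α : Type*} {S : Finset α} {x : Fin R → ℕ → α}
    (h : ∀ r, ∃ k, 1 ≤ k ∧ x r k ∈ S) (r : Fin R) : tourLength S (x r) ≤ kDyn S x := by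
  have hne : {K | AllStopped S x K}.Nonempty := by
    refine ⟨Finset.univ.sup fun r => tourLength S (x r), fun r => ?_⟩
    exact ⟨_, (tourLength_spec (h r)).1,
      Finset.le_sup (f := fun r => tourLength S (x r)) (Finset.mem_univ r),
      (tourLength_spec (h r)).2⟩
  obtain ⟨k, hk, hkK, hkS⟩ := Nat.sInf_mem hne r
  exact (tourLength_le hk hkS).trans hkK

/-- At `K_dyn` no tour is discarded, and the estimator is linear in the numbers of visits. -/
theorem lvs_kDyn_eq (W : Params nV nH) (S : Finset (State nV nH)) (η : ℝ)
    (y : Fin N → (Fin nV → ℝ) × (Fin nH → ℝ)) (x : Fin R → ℕ → State nV nH)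
    (h : ∀ r, ∃ k, 1 ≤ k ∧ x r k ∈ S) :
    lvs W S η y (kDyn S x) x = (η * (R : ℝ)⁻¹) • ∑ r, ∑ s,
      ((visits S s (x r)).toReal • ((N : ℝ)⁻¹ • ∑ n, energyGrad (y n) W)
        - (visits S s (x r)).toReal • energyGrad s.real W) := by
  have hK : ∀ r, 1 ≤ tourLength S (x r) ∧ tourLength S (x r) ≤ kDyn S x := fun r =>
    ⟨(tourLength_spec (h r)).1, tourLength_le_kDyn h r⟩
  have hnum : numFinished S (kDyn S x) x = R := by
    have := sum_finishedTours hK fun _ _ => (1 : ℝ)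
    simpa [numFinished] using this
  have hlen : meanTourLength S (kDyn S x) x
      = (R : ℝ)⁻¹ * ∑ r, ∑ s, (visits S s (x r)).toReal := by
    have := sum_finishedTours hK fun k _ => (k : ℝ)
    simp only [Finset.sum_const, nsmul_eq_mul] at this
    simp only [meanTourLength, hnum, this, sum_toReal_visits (h _), div_eq_inv_mul]
  have hsum : ∑ k ∈ Finset.Icc 1 (kDyn S x), ∑ r ∈ finishedTours S x k, ∑ i ∈ Finset.range k,
      energyGrad (x r i).real W = ∑ r, ∑ s, (visits S s (x r)).toReal • energyGrad s.real W := by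
    rw [sum_finishedTours hK fun k r => ∑ i ∈ Finset.range k, energyGrad (x r i).real W]
    exact Finset.sum_congr rfl fun r _ =>
      (sum_toReal_visits_smul (h r) fun s : State nV nH => energyGrad s.real W).symm
  rw [lvs, hnum, hlen, hsum, mul_smul]
  simp only [Finset.sum_sub_distrib, ← Finset.sum_smul, smul_sub, smul_smul]
  congr 3
  simp only [← Finset.sum_mul]
  ring

/-- The common expectation of the estimators: the completed data enter through
`∑ₙ ∂E(yₙ; W)/∂W` only, which has to be independent of the tours. -/
theorem integrable_and_integral_lvs_kDyn (hN : 1 ≤ N) (hR : 1 ≤ R)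
    (W : Params nV nH) (v : Fin N → Fin nV → Bool) (η : ℝ)
    (S : Finset (State nV nH)) (hS : S.Nonempty)
    (Φ : Matrix (State nV nH) (State nV nH) ℝ)
    (hΦ : Φ ∈ Matrix.rowStochastic ℝ (State nV nH)) (hirr : Φ.IsIrreducible)
    (hstat : Matrix.vecMul (prob W) Φ = prob W)
    {Ω : Type*} [MeasurableSpace Ω] (μ : Measure Ω) [IsProbabilityMeasure μ]
    (X : Fin R → ℕ → Ω → State nV nH)
    (hX : ∀ r, IsMarkovChain μ (startProb W S) Φ (X r))
    (y : Ω → Fin N → (Fin nV → ℝ) × (Fin nH → ℝ))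
    (hy : Integrable (fun ω => ∑ n, energyGrad (y ω n) W) μ)
    (hmean : ∫ ω, ∑ n, energyGrad (y ω n) W ∂μ =
      ∑ n, energyGrad (bits (v n), condMean W (v n)) W)
    (hind : IndepFun (fun ω => ∑ n, energyGrad (y ω n) W) (fun ω r t => X r t ω) μ) :
    (∀ᵐ ω ∂μ, ∃ K, AllStopped S (fun r t => X r t ω) K) ∧
    Integrable (fun ω => lvs W S η (y ω) (kDyn S fun r t => X r t ω) (fun r t => X r t ω)) μ ∧
    ∫ ω, lvs W S η (y ω) (kDyn S fun r t => X r t ω) (fun r t => X r t ω) ∂μ =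
      (η * (partitionFn W / setWeight W S)) • gradient (negLogLik v) W := by
  have hZ := partitionFn_pos W
  have hZS := setWeight_pos W hS
  have hN' : (N : ℝ) ≠ 0 := by exact_mod_cast (by omega : N ≠ 0)
  have hR' : (R : ℝ) ≠ 0 := by exact_mod_cast (by omega : R ≠ 0)
  -- the stationary measure, normalized to have mass one on `S`
  set c : ℝ := partitionFn W / setWeight W S with hc
  set π : State nV nH → ℝ := c • prob W with hπdef
  have hπ : ∀ s, 0 ≤ π s := fun s => mul_nonneg (by positivity) (prob_nonneg W s)
  have hst : Matrix.vecMul π Φ = π := by rw [hπdef, Matrix.smul_vecMul, hstat]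
  have hstart : startProb W S = fun s => if s ∈ S then π s else 0 := by
    funext s
    simp only [startProb, hπdef, hc, prob, Pi.smul_apply, smul_eq_mul]
    congr 1
    field_simp
  rw [hstart] at hX
  have hret : ∀ᵐ ω ∂μ, ∀ r, ∃ k, 1 ≤ k ∧ X r k ω ∈ S :=
    ae_all_iff.2 fun r => (hX r).ae_exists_return hΦ hirr hS hπ hst
  have hvint := fun r s => (hX r).integrable_visits hΦ hirr hS hπ hst s
  have hindv : ∀ r s, IndepFun (fun ω => (visits S s fun t => X r t ω).toReal)
      (fun ω => (N : ℝ)⁻¹ • ∑ n, energyGrad (y ω n) W) μ := fun r s =>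
    (hind.comp (φ := fun Y : Params nV nH => (N : ℝ)⁻¹ • Y)
      (ψ := fun p : Fin R → ℕ → State nV nH => (visits S s (p r)).toReal)
      (measurable_id.const_smul (N : ℝ)⁻¹)
      (((measurable_visits S s).comp (measurable_pi_apply r)).ennreal_toReal)).symm
  have hint1 := fun r s => (hindv r s).integrable_smul (hvint r s) (hy.smul (N : ℝ)⁻¹)
  have hint2 := fun r s => (hvint r s).smul_const (energyGrad (State.real s) W)
  have hintd : ∀ r s, Integrable (fun ω =>
      (visits S s fun t => X r t ω).toReal • ((N : ℝ)⁻¹ • ∑ n, energyGrad (y ω n) W)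
        - (visits S s fun t => X r t ω).toReal • energyGrad s.real W) μ := fun r s =>
    (hint1 r s).sub (hint2 r s)
  have heq : (fun ω => lvs W S η (y ω) (kDyn S fun r t => X r t ω) (fun r t => X r t ω)) =ᵐ[μ]
      fun ω => (η * (R : ℝ)⁻¹) • ∑ r, ∑ s,
        ((visits S s fun t => X r t ω).toReal • ((N : ℝ)⁻¹ • ∑ n, energyGrad (y ω n) W)
          - (visits S s fun t => X r t ω).toReal • energyGrad s.real W) := by
    filter_upwards [hret] with ω hω
    exact lvs_kDyn_eq W S η (y ω) (fun r t => X r t ω) hω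
  have hint : Integrable (fun ω => (η * (R : ℝ)⁻¹) • ∑ r, ∑ s,
        ((visits S s fun t => X r t ω).toReal • ((N : ℝ)⁻¹ • ∑ n, energyGrad (y ω n) W)
          - (visits S s fun t => X r t ω).toReal • energyGrad s.real W)) μ :=
    (integrable_finsetSum _ fun r _ => integrable_finsetSum _ fun s _ =>
      hintd r s).fun_smul _
  refine ⟨?_, hint.congr heq.symm, ?_⟩
  · filter_upwards [hret] with ω hω
    exact ⟨Finset.univ.sup fun r => tourLength S fun t => X r t ω, fun r =>
      ⟨_, (tourLength_spec (hω r)).1,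
        Finset.le_sup (f := fun r => tourLength S fun t => X r t ω) (Finset.mem_univ r),
        (tourLength_spec (hω r)).2⟩⟩
  have hsumprob : ∑ s, prob W s = 1 := by
    simp only [prob, ← Finset.sum_div]
    exact div_self hZ.ne'
  rw [integral_congr_ae heq, integral_smul, integral_finsetSum _ fun r _ =>
    integrable_finsetSum _ fun s _ => hintd r s]
  have hterm : ∀ r, ∫ ω, ∑ s,
        ((visits S s fun t => X r t ω).toReal • ((N : ℝ)⁻¹ • ∑ n, energyGrad (y ω n) W)
          - (visits S s fun t => X r t ω).toReal • energyGrad s.real W) ∂μ =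
      c • gradient (negLogLik v) W := by
    intro r
    rw [integral_finsetSum _ fun s _ => hintd r s]
    have : ∀ s, ∫ ω, ((visits S s fun t => X r t ω).toReal •
          ((N : ℝ)⁻¹ • ∑ n, energyGrad (y ω n) W)
          - (visits S s fun t => X r t ω).toReal • energyGrad s.real W) ∂μ =
        π s • ((N : ℝ)⁻¹ • ∑ n, energyGrad (bits (v n), condMean W (v n)) W)
          - π s • energyGrad s.real W := by
      intro s
      rw [integral_sub (hint1 r s) (hint2 r s), integral_smul_const,
        (hindv r s).integral_fun_smul_eq_smul_integral (hvint r s).aestronglyMeasurable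
          (hy.smul (N : ℝ)⁻¹).aestronglyMeasurable, integral_smul, hmean,
        (hX r).integral_visits hΦ hirr hS hπ hst]
    simp only [this, Finset.sum_sub_distrib, ← Finset.sum_smul]
    rw [(hasGradientAt_negLogLik v W hN).gradient]
    simp only [hπdef, Pi.smul_apply, smul_eq_mul, ← Finset.mul_sum, hsumprob, mul_one, mul_smul,
      ← Finset.smul_sum, smul_sub, energyGrad_eq, smul_neg, Finset.sum_neg_distrib, one_div]
    abel
  simp only [hterm, Finset.sum_const, Finset.card_univ, Fintype.card_fin]
  rw [← Nat.cast_smul_eq_nsmul ℝ, smul_smul, smul_smul]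
  congr 1
  field_simp

/-- The energy gradient at a sampled completion has the energy gradient at the conditional mean as
its expectation. -/
theorem integral_energyGrad_sample (W : Params nV nH) (v : Fin nV → Bool)
    {Ω : Type*} [MeasurableSpace Ω] (μ : Measure Ω) [IsProbabilityMeasure μ]
    {h : Ω → Fin nH → Bool} (hm : Measurable h)
    (hlaw : ∀ g, μ.real {ω | h ω = g} = condProb W v g) :
    Integrable (fun ω => energyGrad (State.real (v, h ω)) W) μ ∧
    ∫ ω, energyGrad (State.real (v, h ω)) W ∂μ = energyGrad (bits v, condMean W v) W := by
  have : IsProbabilityMeasure (μ.map h) := Measure.isProbabilityMeasure_map hm.aemeasurable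
  have hi : Integrable (fun g => energyGrad (State.real (v, g)) W) (μ.map h) := Integrable.of_finite
  refine ⟨hi.comp_measurable hm, ?_⟩
  rw [← integral_map (f := fun g => energyGrad (State.real (v, g)) W) hm.aemeasurable
    hi.aestronglyMeasurable, integral_fintype hi]
  have hreal : ∀ g, (μ.map h).real {g} = condProb W v g := fun g => by
    rw [map_measureReal_apply hm (measurableSet_singleton g), ← hlaw]
    rfl
  simp only [hreal, energyGrad_eq, smul_neg, Finset.sum_neg_distrib, sum_condProb_smul_feature]

theorem gradient_negLogLik_apply_inl (hN : 1 ≤ N) (v : Fin N → Fin nV → Bool) (W : Params nV nH)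
    (i : Fin nV) (j : Fin nH) :
    gradient (negLogLik v) W (Sum.inl (i, j)) =
      -((1 / (N : ℝ)) * ∑ n, bits (v n) i * condMean W (v n) j
        - ∑ x, prob W x * (bits x.1 i * bits x.2 j)) := by
  rw [(hasGradientAt_negLogLik v W hN).gradient, neg_sub]
  simp only [PiLp.sub_apply, PiLp.smul_apply, WithLp.ofLp_sum, Finset.sum_apply, feature,
    State.real, Sum.elim_inl, smul_eq_mul]

end Estimator

end RBM

/-! ### Unbiasedness of the direction of the gradient -/

theorem mainTheorem7 {nV nH N R : ℕ} (hN : 1 ≤ N) (hR : 1 ≤ R)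
    (W : RBM.Params nV nH) (v : Fin N → Fin nV → Bool) (η : ℝ) (hη : 0 < η)
    (S : Finset (RBM.State nV nH)) (hS : S.Nonempty)
    -- an irreducible transition matrix with the model distribution as its steady state
    (Φ : Matrix (RBM.State nV nH) (RBM.State nV nH) ℝ)
    (hΦ : Φ ∈ Matrix.rowStochastic ℝ (RBM.State nV nH))
    (hirr : Φ.IsIrreducible)
    (hstat : Matrix.vecMul (RBM.prob W) Φ = RBM.prob W)
    -- independent runs of the chain, started in the stopping set
    {Ω : Type*} [MeasurableSpace Ω] (μ : Measure Ω) [IsProbabilityMeasure μ]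
    (X : Fin R → ℕ → Ω → RBM.State nV nH)
    (hX : ∀ r, RBM.IsMarkovChain μ (RBM.startProb W S) Φ (X r))
    (hindep : iIndepFun (fun (r : Fin R) (ω : Ω) (t : ℕ) => X r t ω) μ) :
    -- almost surely `K_dyn` is finite, that is, all tours reach the stopping set
    (∀ᵐ ω ∂μ, ∃ K, RBM.AllStopped S (fun r t => X r t ω) K) ∧
    -- the RBM gradient
    DifferentiableAt ℝ (RBM.negLogLik v) W ∧
    (∀ i j, gradient (RBM.negLogLik v) W (Sum.inl (i, j)) =
      -((1 / (N : ℝ)) * ∑ n, RBM.bits (v n) i * RBM.condMean W (v n) j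
        - ∑ x, RBM.prob W x * (RBM.bits x.1 i * RBM.bits x.2 j))) ∧
    -- the factor is positive
    0 < η * (RBM.partitionFn W / RBM.setWeight W S) ∧
    -- training points completed by the conditional means of the hidden units
    (Integrable (fun ω => RBM.lvs W S η (fun n => (RBM.bits (v n), RBM.condMean W (v n)))
        (RBM.kDyn S fun r t => X r t ω) (fun r t => X r t ω)) μ ∧
      ∫ ω, RBM.lvs W S η (fun n => (RBM.bits (v n), RBM.condMean W (v n)))
        (RBM.kDyn S fun r t => X r t ω) (fun r t => X r t ω) ∂μ =
      (η * (RBM.partitionFn W / RBM.setWeight W S)) • gradient (RBM.negLogLik v) W) ∧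
    -- training points completed by hidden states sampled independently of the tours
    (∀ h : Fin N → Ω → Fin nH → Bool,
      (∀ n, Measurable (h n)) →
      (∀ n g, μ.real {ω | h n ω = g} = RBM.condProb W (v n) g) →
      IndepFun (fun (ω : Ω) (n : Fin N) => h n ω)
        (fun (ω : Ω) (r : Fin R) (t : ℕ) => X r t ω) μ →
      Integrable (fun ω => RBM.lvs W S η (fun n => RBM.State.real (v n, h n ω))
        (RBM.kDyn S fun r t => X r t ω) (fun r t => X r t ω)) μ ∧
      ∫ ω, RBM.lvs W S η (fun n => RBM.State.real (v n, h n ω))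
        (RBM.kDyn S fun r t => X r t ω) (fun r t => X r t ω) ∂μ =
      (η * (RBM.partitionFn W / RBM.setWeight W S)) • gradient (RBM.negLogLik v) W) := by
  have key := RBM.integrable_and_integral_lvs_kDyn hN hR W v η S hS Φ hΦ hirr hstat μ X hX
  have hmean := key (fun _ n => (RBM.bits (v n), RBM.condMean W (v n))) (integrable_const _)
    (by simp) (indepFun_const_left _ _)
  refine ⟨hmean.1, (RBM.hasGradientAt_negLogLik v W hN).differentiableAt,
    RBM.gradient_negLogLik_apply_inl hN v W,
    mul_pos hη (div_pos (RBM.partitionFn_pos W) (RBM.setWeight_pos W hS)), hmean.2, ?_⟩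
  intro h hm hlaw hind
  have hs := fun n => RBM.integral_energyGrad_sample W (v n) μ (hm n) (hlaw n)
  refine (key (fun ω n => RBM.State.real (v n, h n ω))
    (integrable_finsetSum _ fun n _ => (hs n).1) ?_ ?_).2
  · rw [integral_finsetSum _ fun n _ => (hs n).1]
    exact Finset.sum_congr rfl fun n _ => (hs n).2
  · exact hind.comp (φ := fun g : Fin N → Fin nH → Bool =>
      ∑ n, RBM.energyGrad (RBM.State.real (v n, g n)) W) (measurable_of_finite _) measurable_id
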